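/- For $n\ge 3$ let the $n$-gon have vertices $0,1,\dots,n-1$ in cyclic order. Arcs $(i,j)$ and $(k,\ell)$ *cross* if $i<k<j<\ell$ or $i<\ell<j<k$ in cyclic order. A *frieze* on the $n$-gon over $\mathbb{Z}[\sqrt2]$ is a map $f$ from pairs of vertices to $\mathbb{Z}[\sqrt2]$ such that $f(i,j)=0$ if and only if $i=j$; $f(i,i\pm1)=1$ (indices mod $n$); $f(i,j)=f(j,i)$; and $f(i,j)f(k,\ell)=f(i,\ell)f(j,k)+f(i,k)f(j,\ell)$ whenever $(i,j)$ and $(k,\ell)$ cross. A *dissection* of the $n$-gon is a set of pairwise non-crossing diagonals; it is a *triangulation* if it divides the $n$-gon into triangles. The *Euclidean frieze* on a $p$-gon has values $\mathcal L_p(a,b)=U_{|b-a|-1}(2\cos(\pi/p))$, where $U_{-1}=0$, $U_0=1$ and $U_k(x)=xU_{k-1}(x)-U_{k-2}(x)$. The *frieze from a dissection* $\mathcal D$ is the frieze that restricts to the Euclidean frieze $\mathcal L_p$ on every subpolygon ($p$-gon) of $\mathcal D$. Consider the following classes of friezes over $\mathbb{Z}[\sqrt2]$ on polygons with any number $n\ge3$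 of vertices: - *friezes from dissections*: the friezes from dissections into triangles and quadrilaterals; - *$\mathbb{Z}_{\ge0}[\sqrt2]$ friezes*: those with every $f(i,j)$, $i<j$, of the form $a+b\sqrt2$ with $a,b\in\mathbb{Z}_{\ge0}$; - *$\mathbb{Z}[\sqrt2]_{\ge1}$ friezes*: those with $f(i,j)\ge1$ for all $i<j$; - *unitary friezes*: those for which some triangulation of the polygon has $f(\tau)\in\mathbb{Z}[\sqrt2]^\times$ for each of its arcs $\tau$. **Proposition.** 1. The set of friezes from dissections is strictly contained in the set of $\mathbb{Z}_{\ge0}[\sqrt2]$ friezes. 2. The set of $\mathbb{Z}_{\ge0}[\sqrt2]$ friezes is strictly contained in the set of $\mathbb{Z}[\sqrt2]_{\ge1}$ friezes. 3. The set of unitary friezes is incomparable (neither set contains the other) with each of the sets of friezes from dissections, of $\mathbb{Z}_{\ge0}[\sqrt2]$ friezes and of $\mathbb{Z}[\sqrt2]_{\ge1}$ friezes. Moreover, there are the following explicit witnesses (indices mod $n$). - On the octagon, there is a frieze with $f(i,i+2)=\sqrt2$ for even $i$ and $1+\sqrt2$ for odd $i$, $f(i,i+3)=1+\sqrt2$ for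 all $i$, and $f(i,i+4)=2$ for even $i$ and $2+\sqrt2$ for odd $i$. It is a $\mathbb{Z}_{\ge0}[\sqrt2]$ frieze that is not from a dissection. - On the hexagon, there is a frieze with $f(i,i+2)=1+\sqrt2,\ \sqrt2,\ 3-\sqrt2$ and $f(i,i+3)=1+\sqrt2,\ -3+3\sqrt2,\ 2\sqrt2$ for $i\equiv0,1,2 \pmod 3$ respectively. It is a $\mathbb{Z}[\sqrt2]_{\ge1}$ frieze that is not a $\mathbb{Z}_{\ge0}[\sqrt2]$ frieze. - On the quadrilateral, there is a frieze with $f(0,2)=-1+\sqrt2$ and $f(1,3)=2+2\sqrt2$. It is unitary and belongs to none of the other three classes. - The Euclidean frieze $\mathcal L_4$ on the quadrilateral is a frieze from a dissection that is not unitary. -/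

import Mathlib

/-- The cyclic successor `i + 1` of a vertex `i` of the `n`-gon with vertices `0, …, n - 1`. -/
abbrev nextVertex {n : ℕ} (i : Fin n) : Fin n := finRotate n i

/-- The cyclic predecessor `i - 1` of a vertex of the `n`-gon. -/
abbrev prevVertex {n : ℕ} (i : Fin n) : Fin n := (finRotate n).symm i

/-- The arcs `(i, j)` and `(k, l)` cross: `i < k < j < l` or `i < l < j < k` in cyclic order. -/
def Crosses {n : ℕ} (i j k l : Fin n) : Prop :=
  (sbtw i k j ∧ sbtw j l i) ∨ (sbtw i l j ∧ sbtw j k i)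

/-- `i` and `j` are joined by a boundary edge of the `n`-gon. -/
def Adjacent {n : ℕ} (i j : Fin n) : Prop := j = nextVertex i ∨ i = nextVertex j

/-- `(i, j)` is a diagonal (a non-boundary arc) of the `n`-gon. -/
def IsDiagonal {n : ℕ} (i j : Fin n) : Prop := i ≠ j ∧ ¬ Adjacent i j

/-- A frieze on the `n`-gon (`3 ≤ n`) with values in `R`; only the integral domain `R = ℤ[√2]`
is used below. -/
structure Frieze (n : ℕ) (R : Type*) [CommRing R] where
  three_le : 3 ≤ n
  val : Fin n → Fin n → R
  eq_zero_iff : ∀ i j, val i j = 0 ↔ i = j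
  next_eq_one : ∀ i, val i (nextVertex i) = 1
  prev_eq_one : ∀ i, val i (prevVertex i) = 1
  symm : ∀ i j, val i j = val j i
  ptolemy : ∀ i j k l, Crosses i j k l →
    val i j * val k l = val i l * val j k + val i k * val j l

/-- A dissection of the `n`-gon: a set of pairwise non-crossing diagonals. -/
structure IsDissection {n : ℕ} (D : Set (Sym2 (Fin n))) : Prop where
  diagonal : ∀ i j, s(i, j) ∈ D → IsDiagonal i j
  noncrossing : ∀ i j k l, s(i, j) ∈ D → s(k, l) ∈ D → ¬ Crosses i j k l

/-- `v 0 < v 1 < ⋯ < v (p - 1)` are the vertices of one of the subpolygons (a `p`-gon) into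
which `D` divides the `n`-gon: every side of this `p`-gon is a boundary edge of the `n`-gon or
an arc of `D`, and no diagonal of this `p`-gon is an arc of `D`. -/
structure IsSubpolygon {n : ℕ} (D : Set (Sym2 (Fin n))) (p : ℕ) (v : Fin p → Fin n) : Prop where
  three_le : 3 ≤ p
  strictMono : StrictMono v
  side : ∀ a, Adjacent (v a) (v (nextVertex a)) ∨ s(v a, v (nextVertex a)) ∈ D
  no_diagonal : ∀ a b, IsDiagonal a b → s(v a, v b) ∉ D

/-- A triangulation: a dissection all of whose subpolygons are triangles. -/
def IsTriangulation {n : ℕ} (T : Set (Sym2 (Fin n))) : Prop :=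
  IsDissection T ∧ ∀ p (v : Fin p → Fin n), IsSubpolygon T p v → p = 3

/-- A dissection into triangles and quadrilaterals. -/
def IsTriQuadDissection {n : ℕ} (D : Set (Sym2 (Fin n))) : Prop :=
  IsDissection D ∧ ∀ p (v : Fin p → Fin n), IsSubpolygon D p v → p = 3 ∨ p = 4

/-- The inclusion `ℤ[√2] → ℝ`. -/
noncomputable def sqrtTwoToReal : ℤ√2 →+* ℝ := Zsqrtd.toReal (by norm_num)

/-- The value `U_{|b - a| - 1}(2 cos (π / p))` of the Euclidean frieze on the `p`-gon at the pair
of vertices `(a, b)`, with `U` the normalized Chebyshev polynomials of the second kind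
(`U_{-1} = 0`, `U_0 = 1`, `U_k = X U_{k-1} - U_{k-2}`), which are Mathlib's `Chebyshev.S`. -/
noncomputable def euclideanFrieze (p : ℕ) (a b : Fin p) : ℝ :=
  (Polynomial.Chebyshev.S ℝ (|((b : ℕ) : ℤ) - ((a : ℕ) : ℤ)| - 1)).eval
    (2 * Real.cos (Real.pi / p))

/-- `f` is the frieze from the dissection `D`: it restricts to the Euclidean frieze on every
subpolygon of `D`. -/
def IsFriezeFrom {n : ℕ} (D : Set (Sym2 (Fin n))) (f : Frieze n (ℤ√2)) : Prop :=
  ∀ p (v : Fin p → Fin n), IsSubpolygon D p v →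
    ∀ a b, sqrtTwoToReal (f.val (v a) (v b)) = euclideanFrieze p a b

/-- `f` is unitary: there is a triangulation of the polygon all of whose arcs have unit weight. -/
def Frieze.IsUnitary {n : ℕ} {R : Type*} [CommRing R] (f : Frieze n R) : Prop :=
  ∃ T : Set (Sym2 (Fin n)), IsTriangulation T ∧ ∀ i j, s(i, j) ∈ T → IsUnit (f.val i j)

/-- All friezes over `ℤ[√2]`, on all polygons. -/
abbrev SqrtTwoFrieze : Type := Σ n : ℕ, Frieze n (ℤ√2)

/-- The friezes from dissections into triangles and quadrilaterals. -/
def dissectionFriezes : Set SqrtTwoFrieze :=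
  {F | ∃ D : Set (Sym2 (Fin F.1)), IsTriQuadDissection D ∧ IsFriezeFrom D F.2}

/-- The friezes whose values at distinct vertices are `a + b √2` with `a, b ≥ 0` integers. -/
def nonnegFriezes : Set SqrtTwoFrieze :=
  {F | ∀ i j : Fin F.1, i < j → 0 ≤ (F.2.val i j).re ∧ 0 ≤ (F.2.val i j).im}

/-- The friezes whose values at distinct vertices are real numbers `≥ 1`. -/
def geOneFriezes : Set SqrtTwoFrieze :=
  {F | ∀ i j : Fin F.1, i < j → 1 ≤ sqrtTwoToReal (F.2.val i j)}

/-- The unitary friezes over `ℤ[√2]`. -/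
def unitaryFriezes : Set SqrtTwoFrieze :=
  {F | F.2.IsUnitary}

/-- Neither set contains the other. -/
def Incomparable {α : Type*} (A B : Set α) : Prop := ¬ A ⊆ B ∧ ¬ B ⊆ A

/-! The substance is that friezes from dissections have nonnegative coefficients
(`Frieze.nonneg_of_isFriezeFrom`), by induction on the number of arcs of `D` crossing `(i, j)`. A
crossing arc `(k, l)` has value 1 (`IsFriezeFrom.val_of_mem`), so Ptolemy writes `f(i, j)` as a sum
of products of values on arcs with fewer crossings (`Crosses.of_not_crosses`). With no crossing, `i`
and `j` share a triangle or quadrilateral (`exists_isSubpolygon`), and the value is 0, 1 or `√2`. A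
nonzero `a + b√2` with `a, b ≥ 0` is at least 1, which completes a chain of three classes. Explicit
friezes show that it is strict and that unitarity is independent of it. -/

/-! ### Crossing arcs in cyclic order. -/

theorem crosses_iff {n : ℕ} {i j k l : Fin n} : Crosses i j k l ↔
    (i < k ∧ k < j ∧ j < l) ∨ (k < j ∧ j < l ∧ l < i) ∨ (j < l ∧ l < i ∧ i < k) ∨
    (l < i ∧ i < k ∧ k < j) ∨ (i < l ∧ l < j ∧ j < k) ∨ (l < j ∧ j < k ∧ k < i) ∨
    (j < k ∧ k < i ∧ i < l) ∨ (k < i ∧ i < l ∧ l < j) := by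
  simp only [Crosses, Fin.sbtw_iff]
  grind

theorem Crosses.swap_left {n : ℕ} {i j k l : Fin n} (h : Crosses i j k l) : Crosses j i k l :=
  (Or.symm h).imp And.symm And.symm

theorem Crosses.swap_right {n : ℕ} {i j k l : Fin n} (h : Crosses i j k l) : Crosses i j l k :=
  Or.symm h

theorem not_crosses_of_mem_left {n : ℕ} {i k l : Fin n} : ¬ Crosses i l k l := by
  rw [crosses_iff]; grind

/-- Read the circle linearly from `i`: if `x` is not before `j`, then it is after `k`. The primed
version is the mirror image. -/
theorem sbtw_or_sbtw_of_sbtw {n : ℕ} {i j k l x : Fin n} (hk : sbtw i k j) (hx : sbtw i x l) :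
    sbtw i x j ∨ sbtw k x l := by
  simp only [Fin.sbtw_iff] at *
  grind

theorem sbtw_or_sbtw_of_sbtw' {n : ℕ} {i j k l y : Fin n} (hk : sbtw j k i) (hy : sbtw l y i) :
    sbtw j y i ∨ sbtw l y k := by
  simp only [Fin.sbtw_iff] at *
  grind

/-- An arc that separates `i` from an end `l` of `(k, l)` without crossing `(k, l)` separates `i`
from everything on the other side of `(k, l)`. -/
theorem Crosses.of_not_crosses {n : ℕ} {i j k l x y : Fin n} (h : Crosses i j k l)
    (hkl : ¬ Crosses k l x y) (hil : Crosses i l x y) : Crosses i j x y := by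
  wlog hxy : sbtw i x l ∧ sbtw l y i generalizing x y
  · exact (this (fun h => hkl h.swap_right) hil.swap_right (hil.resolve_left hxy)).swap_right
  obtain ⟨hx, hy⟩ := hxy
  rcases h with ⟨hk, hl⟩ | ⟨hl, hk⟩
  · have hyk : sbtw l y k := hy.trans_right (hk.trans_right hl.cyclic_right).cyclic_right
    have hxj := (sbtw_or_sbtw_of_sbtw hk hx).resolve_right fun h => hkl (Or.inl ⟨h, hyk⟩)
    exact Or.inl ⟨hxj, hl.trans_left hy⟩
  · have hxk : sbtw k x l := ((hl.cyclic_left.trans_left hk).cyclic_left).trans_left hx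
    have hyj := (sbtw_or_sbtw_of_sbtw' hk hy).resolve_right fun h => hkl (Or.inl ⟨hxk, h⟩)
    exact Or.inl ⟨hx.trans_right hl, hyj⟩

theorem nextVertex_val {n : ℕ} (i : Fin n) :
    (nextVertex i : ℕ) = if (i : ℕ) + 1 = n then 0 else (i : ℕ) + 1 := by
  obtain _ | n := n
  · exact i.elim0
  · rw [nextVertex, coe_finRotate]
    simp [Fin.ext_iff]

theorem adjacent_iff {n : ℕ} {i j : Fin n} : Adjacent i j ↔
    (j : ℕ) = (if (i : ℕ) + 1 = n then 0 else (i : ℕ) + 1) ∨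
    (i : ℕ) = (if (j : ℕ) + 1 = n then 0 else (j : ℕ) + 1) := by
  simp only [Adjacent, Fin.ext_iff, nextVertex_val]

theorem Adjacent.symm {n : ℕ} {i j : Fin n} (h : Adjacent i j) : Adjacent j i := Or.symm h

/-! ### Inscribed polygons and subpolygons. -/

/-- The vertices of a polygon inscribed in the `n`-gon all of whose sides are boundary edges
or arcs of `D`. -/
def IsInscribed {n : ℕ} (D : Set (Sym2 (Fin n))) (S : Finset (Fin n)) : Prop :=
  2 < S.card ∧ ∀ x ∈ S, ∀ y ∈ S, x < y →
    ((∀ z ∈ S, z ≤ x ∨ y ≤ z) ∨ ∀ z ∈ S, x ≤ z ∧ z ≤ y) → Adjacent x y ∨ s(x, y) ∈ D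

theorem isInscribed_univ {n : ℕ} (hn : 3 ≤ n) (D : Set (Sym2 (Fin n))) :
    IsInscribed D Finset.univ := by
  refine ⟨by simpa [Nat.lt_iff_add_one_le] using hn, fun x _ y _ hxy h => Or.inl ?_⟩
  rw [adjacent_iff]
  have hx := x.2
  have hy := y.2
  have hxy' : (x : ℕ) < y := hxy
  rcases h with h | h
  · left
    rw [if_neg (by omega)]
    have := h ⟨x + 1, by omega⟩ (Finset.mem_univ _)
    simp only [Fin.le_def] at this
    omega
  · right
    have h0 := (h ⟨0, by omega⟩ (Finset.mem_univ _)).1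
    have h1 := (h ⟨n - 1, by omega⟩ (Finset.mem_univ _)).2
    simp only [Fin.le_def] at h0 h1
    rw [if_pos (by omega)]
    omega

/-- Cutting along `(a, b)` makes that arc the side from least to greatest vertex; `c` supplies the
third vertex. -/
theorem IsInscribed.inner {n : ℕ} {D : Set (Sym2 (Fin n))} {S : Finset (Fin n)}
    (hS : IsInscribed D S) {a b c : Fin n} (ha : a ∈ S) (hb : b ∈ S) (hc : c ∈ S)
    (hac : a < c) (hcb : c < b) (hab : s(a, b) ∈ D) :
    IsInscribed D (S.filter fun x => a ≤ x ∧ x ≤ b) := by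
  refine ⟨Finset.two_lt_card.2 ⟨a, ?_, c, ?_, b, ?_, hac.ne, (hac.trans hcb).ne, hcb.ne⟩,
    fun x hx y hy hxy h => ?_⟩
  · simp [ha, (hac.trans hcb).le]
  · simp [hc, hac.le, hcb.le]
  · simp [hb, (hac.trans hcb).le]
  · simp only [Finset.mem_filter] at hx hy h
    rcases h with h | h
    · exact hS.2 x hx.1 y hy.1 hxy (Or.inl fun z hz => by grind)
    · have hxa : x = a := by grind
      have hyb : y = b := by grind
      exact Or.inr (hxa ▸ hyb ▸ hab)

/-- On the other piece `a` and `b` become consecutive, and `d` supplies the third vertex. -/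
theorem IsInscribed.outer {n : ℕ} {D : Set (Sym2 (Fin n))} {S : Finset (Fin n)}
    (hS : IsInscribed D S) {a b d : Fin n} (ha : a ∈ S) (hb : b ∈ S) (hd : d ∈ S)
    (hlt : a < b) (hdab : d < a ∨ b < d) (hab : s(a, b) ∈ D) :
    IsInscribed D (S.filter fun x => x ≤ a ∨ b ≤ x) := by
  refine ⟨Finset.two_lt_card.2 ⟨a, ?_, b, ?_, d, ?_, hlt.ne, by grind, by grind⟩,
    fun x hx y hy hxy h => ?_⟩
  · simp [ha]
  · simp [hb]
  · simp only [Finset.mem_filter, hd, true_and]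
    exact hdab.imp le_of_lt le_of_lt
  · simp only [Finset.mem_filter] at hx hy h
    by_cases hxy' : x ≤ a ∧ b ≤ y
    · rcases h with h | h
      · have hxa : x = a := by grind
        have hyb : y = b := by grind
        exact Or.inr (hxa ▸ hyb ▸ hab)
      · exact hS.2 x hx.1 y hy.1 hxy (Or.inr fun z hz => by grind)
    · rcases h with h | h
      · exact hS.2 x hx.1 y hy.1 hxy (Or.inl fun z hz => by grind)
      · exact absurd ⟨(h a ⟨ha, Or.inl le_rfl⟩).1, (h b ⟨hb, Or.inr le_rfl⟩).2⟩ hxy'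

/-- The increasing enumeration of an inscribed polygon that no arc of `D` cuts. -/
theorem IsInscribed.isSubpolygon {n : ℕ} {D : Set (Sym2 (Fin n))} {S : Finset (Fin n)}
    (hS : IsInscribed D S)
    (hcut : ∀ a ∈ S, ∀ b ∈ S, ∀ c ∈ S, ∀ d ∈ S, a < c → c < b → (d < a ∨ b < d) → s(a, b) ∉ D) :
    IsSubpolygon D S.card (S.orderEmbOfFin rfl) := by
  set v := S.orderEmbOfFin rfl with hv
  have hmem : ∀ a, v a ∈ S := S.orderEmbOfFin_mem rfl
  have hsurj : ∀ z ∈ S, ∃ c, v c = z := fun z hz => by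
    have : z ∈ Set.range v := by rw [hv, Finset.range_orderEmbOfFin]; exact hz
    exact this
  have hcard := hS.1
  have key : ∀ a b, a < b → IsDiagonal a b → s(v a, v b) ∉ D := by
    intro a b hab hd
    have hd := hd.2
    rw [adjacent_iff] at hd
    have ha := a.2
    have hb := b.2
    have hab' : (a : ℕ) < b := hab
    rw [if_neg (by omega)] at hd
    -- Nonadjacency excludes `a = 0`, `b = S.card - 1`, so the first or the last vertex lies outside
    -- `[a, b]`.
    obtain ⟨d, hd⟩ : ∃ d : Fin S.card, d < a ∨ b < d := by
      by_cases h0 : (a : ℕ) = 0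
      · exact ⟨⟨S.card - 1, by omega⟩, Or.inr (by
          rw [Fin.lt_def]; split_ifs at hd <;> grind)⟩
      · exact ⟨⟨0, by omega⟩, Or.inl (by rw [Fin.lt_def]; simp; omega)⟩
    refine hcut (v a) (hmem _) (v b) (hmem _) (v ⟨a + 1, by omega⟩) (hmem _) (v d) (hmem _)
      (v.lt_iff_lt.2 ?_) (v.lt_iff_lt.2 ?_) (hd.imp v.lt_iff_lt.2 v.lt_iff_lt.2)
    · simp [Fin.lt_def]
    · rw [Fin.lt_def]; simp; omega
  refine ⟨hcard, v.strictMono, fun a => ?_, fun a b hd => ?_⟩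
  · have ha := a.2
    have hnext := nextVertex_val a
    split_ifs at hnext with h
    · have hlt : nextVertex a < a := by rw [Fin.lt_def]; omega
      refine (hS.2 _ (hmem _) _ (hmem _) (v.lt_iff_lt.2 hlt) (Or.inr fun z hz => ?_)).imp
        Adjacent.symm fun h' => Sym2.eq_swap ▸ h'
      obtain ⟨c, rfl⟩ := hsurj z hz
      have hc := c.2
      simp only [v.le_iff_le, Fin.le_def]
      omega
    · have hlt : a < nextVertex a := by rw [Fin.lt_def]; omega
      refine hS.2 _ (hmem _) _ (hmem _) (v.lt_iff_lt.2 hlt) (Or.inl fun z hz => ?_)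
      obtain ⟨c, rfl⟩ := hsurj z hz
      simp only [v.le_iff_le, Fin.le_def]
      omega
  · rcases lt_or_gt_of_ne hd.1 with h | h
    · exact key a b h hd
    · rw [Sym2.eq_swap]
      exact key b a h ⟨hd.1.symm, fun h' => hd.2 h'.symm⟩

/-- Two vertices that no arc of `D` separates lie on a common subpolygon. -/
theorem exists_isSubpolygon {n : ℕ} (hn : 3 ≤ n) {D : Set (Sym2 (Fin n))} {i j : Fin n}
    (hij : ∀ x y, s(x, y) ∈ D → ¬ Crosses i j x y) :
    ∃ (p : ℕ) (v : Fin p → Fin n), IsSubpolygon D p v ∧ ∃ a b, v a = i ∧ v b = j := by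
  -- Take a smallest inscribed polygon through `i` and `j`. An arc of `D` cutting it would leave
  -- both on one piece, which is smaller.
  obtain ⟨S, ⟨hS, hi, hj⟩, hmin⟩ := WellFounded.has_min
    (InvImage.wf (Finset.card : Finset (Fin n) → ℕ) Nat.lt_wfRel.wf)
    {S : Finset (Fin n) | IsInscribed D S ∧ i ∈ S ∧ j ∈ S}
    ⟨_, isInscribed_univ hn D, Finset.mem_univ _, Finset.mem_univ _⟩
  have hsub := hS.isSubpolygon fun a ha b hb c hc d hd hac hcb hdab hab => by
    have hx := hij a b hab
    rw [crosses_iff] at hx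
    by_cases hin : (a ≤ i ∧ i ≤ b) ∧ (a ≤ j ∧ j ≤ b)
    · refine hmin _ ⟨hS.inner ha hb hc hac hcb hab, by simp [hi, hin.1], by simp [hj, hin.2]⟩ ?_
      exact Finset.card_lt_card (Finset.filter_ssubset.2 ⟨d, hd, by grind⟩)
    · refine hmin _ ⟨hS.outer ha hb hd (hac.trans hcb) hdab hab, ?_, ?_⟩ ?_
      · simp only [Finset.mem_filter, hi, true_and]; grind
      · simp only [Finset.mem_filter, hj, true_and]; grind
      · exact Finset.card_lt_card (Finset.filter_ssubset.2 ⟨c, hc, by grind⟩)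
  have hsurj : ∀ z ∈ S, ∃ c, S.orderEmbOfFin rfl c = z := fun z hz => by
    have : z ∈ Set.range (S.orderEmbOfFin rfl) := by rw [Finset.range_orderEmbOfFin]; exact hz
    exact this
  obtain ⟨a, ha⟩ := hsurj i hi
  obtain ⟨b, hb⟩ := hsurj j hj
  exact ⟨_, _, hsub, a, b, ha, hb⟩

/-! ### Values on subpolygons and positivity. -/

theorem sqrtTwoToReal_injective : Function.Injective sqrtTwoToReal :=
  Zsqrtd.toReal_injective _ fun n h => by
    have h1 : n < 2 := by nlinarith
    have h2 : -2 < n := by nlinarith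
    interval_cases n <;> omega

theorem sqrtTwoToReal_mk (a b : ℤ) : sqrtTwoToReal ⟨a, b⟩ = a + b * √2 := by
  simp [sqrtTwoToReal, Zsqrtd.toReal, Zsqrtd.lift]

theorem euclideanFrieze_three {a b : Fin 3} (h : a ≠ b) : euclideanFrieze 3 a b = 1 := by
  fin_cases a <;> fin_cases b <;> simp_all [euclideanFrieze, Polynomial.Chebyshev.S_one]

theorem euclideanFrieze_four (a b : Fin 4) : euclideanFrieze 4 a b =
    sqrtTwoToReal (![![0, 1, ⟨0, 1⟩, 1], ![1, 0, 1, ⟨0, 1⟩], ![⟨0, 1⟩, 1, 0, 1],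
      ![1, ⟨0, 1⟩, 1, 0]] a b) := by
  have h : 2 * (√2 / 2) = √2 := by ring
  fin_cases a <;> fin_cases b <;>
    norm_num [euclideanFrieze, Polynomial.Chebyshev.S_one, Polynomial.Chebyshev.S_two,
      Polynomial.Chebyshev.S_neg_one, sqrtTwoToReal_mk, h]

/-- Values on the subpolygons of a dissection into triangles and quadrilaterals. -/
theorem IsFriezeFrom.val_eq {n : ℕ} {D : Set (Sym2 (Fin n))} {f : Frieze n (ℤ√2)}
    (hf : IsFriezeFrom D f) {p : ℕ} (hp : p = 3 ∨ p = 4) {v : Fin p → Fin n}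
    (hv : IsSubpolygon D p v) {a b : Fin p} (hab : a ≠ b) :
    f.val (v a) (v b) = 1 ∨ f.val (v a) (v b) = ⟨0, 1⟩ ∧ IsDiagonal a b := by
  have h := hf p v hv a b
  rcases hp with rfl | rfl
  · rw [euclideanFrieze_three hab, ← map_one sqrtTwoToReal] at h
    exact Or.inl (sqrtTwoToReal_injective h)
  · rw [euclideanFrieze_four] at h
    rw [sqrtTwoToReal_injective h, IsDiagonal, adjacent_iff]
    clear h
    revert a b
    decide

/-- No arc of `D` separates the ends, so they share a subpolygon, where `√2` occurs only on
diagonals, and these are not in `D`. -/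
theorem IsFriezeFrom.val_of_mem {n : ℕ} {D : Set (Sym2 (Fin n))} {f : Frieze n (ℤ√2)}
    (hD : IsTriQuadDissection D) (hf : IsFriezeFrom D f) {i j : Fin n} (hij : s(i, j) ∈ D) :
    f.val i j = 1 := by
  obtain ⟨p, v, hv, a, b, rfl, rfl⟩ := exists_isSubpolygon f.three_le
    fun x y => hD.1.noncrossing i j x y hij
  have hab : a ≠ b := fun h => (hD.1.diagonal _ _ hij).1 (congrArg v h)
  exact (hf.val_eq (hD.2 p v hv) hv hab).resolve_right fun h => hv.no_diagonal a b h.2 hij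

theorem Frieze.nonneg_of_isFriezeFrom {n : ℕ} {D : Set (Sym2 (Fin n))} {f : Frieze n (ℤ√2)}
    (hD : IsTriQuadDissection D) (hf : IsFriezeFrom D f) (i j : Fin n) :
    0 ≤ (f.val i j).re ∧ 0 ≤ (f.val i j).im := by
  classical
  let C : Fin n → Fin n → Finset (Fin n × Fin n) := fun i j =>
    Finset.univ.filter fun q => s(q.1, q.2) ∈ D ∧ Crosses i j q.1 q.2
  -- The drop is strict because `(k, l)` crosses `(i, j)` but not `(i, l)`, with which it shares an
  -- end.
  have hlt : ∀ {i j k l}, s(k, l) ∈ D → Crosses i j k l → (C i l).card < (C i j).card := by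
    intro i j k l hkl h
    refine Finset.card_lt_card (Finset.ssubset_iff_of_subset (fun q hq => ?_) |>.2
      ⟨(k, l), by simp [C, hkl, h], by simp [C, not_crosses_of_mem_left]⟩)
    simp only [C, Finset.mem_filter, Finset.mem_univ, true_and] at hq ⊢
    exact ⟨hq.1, h.of_not_crosses (hD.1.noncrossing _ _ _ _ hkl hq.1) hq.2⟩
  suffices H : ∀ m i j, (C i j).card = m → 0 ≤ (f.val i j).re ∧ 0 ≤ (f.val i j).im from
    H _ i j rfl
  clear i j
  intro m
  induction m using Nat.strong_induction_on with
  | _ m ih =>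
  rintro i j rfl
  by_cases hij : i = j
  · simp [(f.eq_zero_iff i j).2 hij]
  by_cases hc : ∃ k l, s(k, l) ∈ D ∧ Crosses i j k l
  · obtain ⟨k, l, hkl, h⟩ := hc
    have hlk : s(l, k) ∈ D := Sym2.eq_swap ▸ hkl
    have hsymm : (C j i).card = (C i j).card := congrArg Finset.card (Finset.filter_congr
      fun q _ => and_congr_right fun _ => ⟨Crosses.swap_left, Crosses.swap_left⟩)
    have hp := f.ptolemy i j k l h
    rw [hf.val_of_mem hD hkl, mul_one] at hp
    obtain ⟨h1, h1'⟩ := ih _ (hlt hkl h) i l rfl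
    obtain ⟨h2, h2'⟩ := ih _ ((hlt hlk h.swap_right.swap_left).trans_eq hsymm) j k rfl
    obtain ⟨h3, h3'⟩ := ih _ (hlt hlk h.swap_right) i k rfl
    obtain ⟨h4, h4'⟩ := ih _ ((hlt hkl h.swap_left).trans_eq hsymm) j l rfl
    rw [hp]
    simp only [Zsqrtd.re_add, Zsqrtd.im_add, Zsqrtd.re_mul, Zsqrtd.im_mul]
    constructor <;> positivity
  · push Not at hc
    obtain ⟨p, v, hv, a, b, rfl, rfl⟩ := exists_isSubpolygon f.three_le hc
    rcases hf.val_eq (hD.2 p v hv) hv fun h => hij (congrArg v h) with h | h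
    · simp [h]
    · simp [h.1]

theorem dissectionFriezes_subset_nonnegFriezes : dissectionFriezes ⊆ nonnegFriezes :=
  fun _ ⟨_, hD, hf⟩ i j _ => Frieze.nonneg_of_isFriezeFrom hD hf i j

theorem nonnegFriezes_subset_geOneFriezes : nonnegFriezes ⊆ geOneFriezes := by
  intro F hF i j hij
  obtain ⟨h1, h2⟩ := hF i j hij
  have h0 : F.2.val i j ≠ 0 := fun h => hij.ne ((F.2.eq_zero_iff i j).1 h)
  generalize F.2.val i j = z at *
  obtain ⟨a, b⟩ := z
  rw [sqrtTwoToReal_mk]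
  simp only at h1 h2
  have h3 : 1 ≤ a + b := by
    by_contra h
    exact h0 (Zsqrtd.ext (by simp; omega) (by simp; omega))
  have h4 : (1 : ℝ) ≤ √2 := Real.one_le_sqrt.2 one_le_two
  have h5 : (0 : ℝ) ≤ b := by exact_mod_cast h2
  have h6 : (1 : ℝ) ≤ a + b := by exact_mod_cast h3
  nlinarith

/-! ### Explicit friezes. -/

/-- A frieze from a symmetric array whose Ptolemy relations hold on increasing quadruples. -/
def Frieze.ofIncreasing {n : ℕ} {R : Type*} [CommRing R] (hn : 3 ≤ n) (v : Fin n → Fin n → R)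
    (h0 : ∀ i j, v i j = 0 ↔ i = j) (h1 : ∀ i, v i (nextVertex i) = 1)
    (hs : ∀ i j, v i j = v j i)
    (hp : ∀ i j k l, i < j → j < k → k < l → v i k * v j l = v i j * v k l + v i l * v j k) :
    Frieze n R where
  three_le := hn
  val := v
  eq_zero_iff := h0
  next_eq_one := h1
  prev_eq_one i := by
    rw [hs]
    have h := h1 (prevVertex i)
    rwa [show nextVertex (prevVertex i) = i from (finRotate n).apply_symm_apply i] at h
  symm := hs
  ptolemy i j k l h := by
    have hji := hs j i
    have hki := hs k i
    have hli := hs l i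
    have hkj := hs k j
    have hlj := hs l j
    have hlk := hs l k
    rcases crosses_iff.1 h with ⟨a, b, c⟩ | ⟨a, b, c⟩ | ⟨a, b, c⟩ | ⟨a, b, c⟩ | ⟨a, b, c⟩ |
      ⟨a, b, c⟩ | ⟨a, b, c⟩ | ⟨a, b, c⟩ <;>
    · have := hp _ _ _ _ a b c
      simp only [hji, hki, hli, hkj, hlj, hlk] at this ⊢
      linear_combination this

/-- The octagon frieze with `f(i, i + 2)` alternating between `√2` and `1 + √2`. -/
def octagonFrieze : Frieze 8 (ℤ√2) :=
  .ofIncreasing (by norm_num)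
    -- Subtraction in `Fin 8` is cyclic, so each vector lists the values from `i` all the way round.
    (fun i j => if i % 2 = 0
      then ![0, 1, ⟨0, 1⟩, ⟨1, 1⟩, ⟨2, 0⟩, ⟨1, 1⟩, ⟨0, 1⟩, 1] (j - i)
      else ![0, 1, ⟨1, 1⟩, ⟨1, 1⟩, ⟨2, 1⟩, ⟨1, 1⟩, ⟨1, 1⟩, 1] (j - i))
    (by decide +kernel) (by decide +kernel) (by decide +kernel) (by decide +kernel)

/-- A hexagon frieze with real values at least `1` but with some negative coefficients. -/
def hexagonFrieze : Frieze 6 (ℤ√2) :=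
  .ofIncreasing (by norm_num)
    ![![0, 1, ⟨1, 1⟩, ⟨1, 1⟩, ⟨0, 1⟩, 1],
      ![1, 0, 1, ⟨0, 1⟩, ⟨-3, 3⟩, ⟨3, -1⟩],
      ![⟨1, 1⟩, 1, 0, 1, ⟨3, -1⟩, ⟨0, 2⟩],
      ![⟨1, 1⟩, ⟨0, 1⟩, 1, 0, 1, ⟨1, 1⟩],
      ![⟨0, 1⟩, ⟨-3, 3⟩, ⟨3, -1⟩, 1, 0, 1],
      ![1, ⟨3, -1⟩, ⟨0, 2⟩, ⟨1, 1⟩, 1, 0]]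
    (by decide +kernel) (by decide +kernel) (by decide +kernel) (by decide +kernel)

/-- The quadrilateral frieze with diagonals `-1 + √2` and `2 + 2√2`. -/
def unitaryQuadFrieze : Frieze 4 (ℤ√2) :=
  .ofIncreasing (by norm_num)
    -- Ptolemy only requires the two diagonals to multiply to 2, so one can be a unit smaller than
    -- 1.
    ![![0, 1, ⟨-1, 1⟩, 1], ![1, 0, 1, ⟨2, 2⟩], ![⟨-1, 1⟩, 1, 0, 1], ![1, ⟨2, 2⟩, 1, 0]]
    (by decide +kernel) (by decide +kernel) (by decide +kernel) (by decide +kernel)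

/-- The Euclidean frieze on the quadrilateral. -/
def euclideanQuadFrieze : Frieze 4 (ℤ√2) :=
  .ofIncreasing (by norm_num)
    ![![0, 1, ⟨0, 1⟩, 1], ![1, 0, 1, ⟨0, 1⟩], ![⟨0, 1⟩, 1, 0, 1], ![1, ⟨0, 1⟩, 1, 0]]
    (by decide +kernel) (by decide +kernel) (by decide +kernel) (by decide +kernel)

/-! ### Membership of the explicit friezes. -/

theorem isSubpolygon_empty {n : ℕ} (hn : 3 ≤ n) :
    IsSubpolygon (∅ : Set (Sym2 (Fin n))) n id :=
  ⟨hn, strictMono_id, fun _ => Or.inl (Or.inl rfl), fun _ _ _ => id⟩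

theorem IsSubpolygon.le {n p : ℕ} {D : Set (Sym2 (Fin n))} {v : Fin p → Fin n}
    (hv : IsSubpolygon D p v) : p ≤ n := by
  simpa using Fintype.card_le_of_injective v hv.strictMono.injective

theorem octagonFrieze_mem_nonnegFriezes : (⟨8, octagonFrieze⟩ : SqrtTwoFrieze) ∈ nonnegFriezes := by
  change ∀ i j : Fin 8, i < j →
    0 ≤ (octagonFrieze.val i j).re ∧ 0 ≤ (octagonFrieze.val i j).im
  decide +kernel

theorem octagonFrieze_val_ne_one {i j : Fin 8} (h : IsDiagonal i j) :
    octagonFrieze.val i j ≠ 1 := by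
  rw [IsDiagonal, adjacent_iff] at h
  revert i j
  decide +kernel

theorem octagonFrieze_notMem_dissectionFriezes :
    (⟨8, octagonFrieze⟩ : SqrtTwoFrieze) ∉ dissectionFriezes := by
  rintro ⟨D, hD, hf⟩
  -- Arcs of `D` have value 1, but no diagonal here does; the octagon would then be its own
  -- subpolygon.
  have hempty : D = ∅ := Set.eq_empty_of_forall_notMem fun e he => by
    induction e with
    | _ i j => exact octagonFrieze_val_ne_one (hD.1.diagonal i j he) (hf.val_of_mem hD he)
  subst hempty
  have := hD.2 8 id (isSubpolygon_empty (by norm_num))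
  omega

theorem hexagonFrieze_mem_geOneFriezes : (⟨6, hexagonFrieze⟩ : SqrtTwoFrieze) ∈ geOneFriezes := by
  have h1 : (1.4 : ℝ) < √2 := Real.lt_sqrt_of_sq_lt (by norm_num)
  have h2 : √2 < (1.5 : ℝ) := (Real.sqrt_lt' (by norm_num)).2 (by norm_num)
  have key : ∀ i j : Fin 6, i < j → hexagonFrieze.val i j ∈
      ([1, ⟨1, 1⟩, ⟨0, 1⟩, ⟨3, -1⟩, ⟨-3, 3⟩, ⟨0, 2⟩] : List (ℤ√2)) := by decide +kernel
  intro i j hij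
  have h := key i j hij
  change 1 ≤ sqrtTwoToReal (hexagonFrieze.val i j)
  simp only [List.mem_cons, List.not_mem_nil, or_false] at h
  rcases h with h | h | h | h | h | h <;> rw [h]
  · simp
  all_goals
    rw [sqrtTwoToReal_mk]
    push_cast
    linarith

theorem hexagonFrieze_notMem_nonnegFriezes :
    (⟨6, hexagonFrieze⟩ : SqrtTwoFrieze) ∉ nonnegFriezes := fun h => by
  have : 0 ≤ (hexagonFrieze.val 2 4).im := (h (2 : Fin 6) (4 : Fin 6) (by decide)).2
  revert this
  decide +kernel

theorem unitaryQuadFrieze_mem_unitaryFriezes :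
    (⟨4, unitaryQuadFrieze⟩ : SqrtTwoFrieze) ∈ unitaryFriezes := by
  have h02 : IsDiagonal (0 : Fin 4) 2 := by rw [IsDiagonal, adjacent_iff]; decide
  have hcases : ∀ {i j : Fin 4}, s(i, j) ∈ ({s(0, 2)} : Set (Sym2 (Fin 4))) →
      i = 0 ∧ j = 2 ∨ i = 2 ∧ j = 0 := fun h => by simpa using h
  have hunit : IsUnit (⟨-1, 1⟩ : ℤ√2) :=
    IsUnit.of_mul_eq_one (⟨1, 1⟩ : ℤ√2) (by decide)
  refine ⟨{s(0, 2)}, ⟨⟨fun i j h => ?_, fun i j k l h h' => ?_⟩, fun p v hv => ?_⟩, fun i j h => ?_⟩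
  · rcases hcases h with ⟨rfl, rfl⟩ | ⟨rfl, rfl⟩
    · exact h02
    · exact ⟨h02.1.symm, fun h => h02.2 h.symm⟩
  · rw [crosses_iff]
    rcases hcases h with ⟨rfl, rfl⟩ | ⟨rfl, rfl⟩ <;>
    rcases hcases h' with ⟨rfl, rfl⟩ | ⟨rfl, rfl⟩ <;> decide
  · have h3 := hv.three_le
    have h4 : p ≤ 4 := hv.le
    by_contra hp
    obtain rfl : p = 4 := by omega
    obtain rfl := hv.strictMono.eq_id
    exact hv.no_diagonal 0 2 h02 rfl
  · rcases hcases h with ⟨rfl, rfl⟩ | ⟨rfl, rfl⟩ <;> exact hunit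

theorem unitaryQuadFrieze_notMem_geOneFriezes :
    (⟨4, unitaryQuadFrieze⟩ : SqrtTwoFrieze) ∉ geOneFriezes := fun h => by
  have h1 : 1 ≤ sqrtTwoToReal ⟨-1, 1⟩ := h (0 : Fin 4) (2 : Fin 4) (by decide)
  have h2 : √2 < (1.5 : ℝ) := (Real.sqrt_lt' (by norm_num)).2 (by norm_num)
  rw [sqrtTwoToReal_mk] at h1
  push_cast at h1
  linarith

theorem euclideanQuadFrieze_val (a b : Fin 4) :
    sqrtTwoToReal (euclideanQuadFrieze.val a b) = euclideanFrieze 4 a b :=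
  (euclideanFrieze_four a b).symm

theorem euclideanQuadFrieze_mem_dissectionFriezes :
    (⟨4, euclideanQuadFrieze⟩ : SqrtTwoFrieze) ∈ dissectionFriezes := by
  refine ⟨∅, ⟨⟨fun _ _ h => h.elim, fun _ _ _ _ h => h.elim⟩, fun p v hv => ?_⟩,
    fun p v hv a b => ?_⟩
  · have h3 := hv.three_le
    have h4 : p ≤ 4 := hv.le
    omega
  · have h3 := hv.three_le
    have h4 : p ≤ 4 := hv.le
    obtain rfl | rfl : p = 3 ∨ p = 4 := by omega
    -- With no arcs available, three vertices of a quadrilateral would have to be pairwise adjacent.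
    · exfalso
      have h01 : v 0 < v 1 := hv.strictMono (by decide)
      have h12 : v 1 < v 2 := hv.strictMono (by decide)
      have side : ∀ a, Adjacent (v a) (v (nextVertex a)) := fun a =>
        (hv.side a).resolve_right id
      have s0 : Adjacent (v 0) (v 1) := side 0
      have s1 : Adjacent (v 1) (v 2) := side 1
      have s2 : Adjacent (v 2) (v 0) := side 2
      rw [adjacent_iff] at s0 s1 s2
      generalize v 0 = x, v 1 = y, v 2 = z at *
      clear side hv
      revert x y z
      decide
    · obtain rfl := hv.strictMono.eq_id
      exact euclideanQuadFrieze_val a b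

theorem euclideanQuadFrieze_notMem_unitaryFriezes :
    (⟨4, euclideanQuadFrieze⟩ : SqrtTwoFrieze) ∉ unitaryFriezes := by
  rintro ⟨T, ⟨hT, hT3⟩, hunit⟩
  -- The norm of `√2` is `-2`.
  have hsqrt : ¬ IsUnit (⟨0, 1⟩ : ℤ√2) := fun h => by
    have := (Zsqrtd.isUnit_iff_norm_isUnit _).1 h
    rw [Int.isUnit_iff] at this
    revert this
    decide
  have hval : ∀ i j : Fin 4, IsDiagonal i j → euclideanQuadFrieze.val i j = ⟨0, 1⟩ := by
    intro i j h
    rw [IsDiagonal, adjacent_iff] at h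
    revert i j
    decide +kernel
  have hempty : T = ∅ := Set.eq_empty_of_forall_notMem fun e he => by
    induction e with
    | _ i j => exact hsqrt (hval i j (hT.diagonal i j he) ▸ hunit i j he)
  subst hempty
  have := hT3 4 id (isSubpolygon_empty (by norm_num))
  omega

theorem mainTheorem6 :
    -- the containments and non-containments
    dissectionFriezes ⊂ nonnegFriezes ∧
    nonnegFriezes ⊂ geOneFriezes ∧
    Incomparable unitaryFriezes dissectionFriezes ∧
    Incomparable unitaryFriezes nonnegFriezes ∧
    Incomparable unitaryFriezes geOneFriezes ∧
    -- an octagon frieze in `nonnegFriezes` but not from a dissection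
    (∃ f : Frieze 8 (ℤ√2),
      (∀ i, f.val i (i + 2) =
        ![⟨0, 1⟩, ⟨1, 1⟩, ⟨0, 1⟩, ⟨1, 1⟩, ⟨0, 1⟩, ⟨1, 1⟩, ⟨0, 1⟩, ⟨1, 1⟩] i) ∧
      (∀ i, f.val i (i + 3) = ⟨1, 1⟩) ∧
      (∀ i, f.val i (i + 4) =
        ![⟨2, 0⟩, ⟨2, 1⟩, ⟨2, 0⟩, ⟨2, 1⟩, ⟨2, 0⟩, ⟨2, 1⟩, ⟨2, 0⟩, ⟨2, 1⟩] i) ∧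
      (⟨8, f⟩ : SqrtTwoFrieze) ∈ nonnegFriezes ∧
      (⟨8, f⟩ : SqrtTwoFrieze) ∉ dissectionFriezes) ∧
    -- a hexagon frieze in `geOneFriezes` but not in `nonnegFriezes`
    (∃ f : Frieze 6 (ℤ√2),
      (∀ i, f.val i (i + 2) =
        ![⟨1, 1⟩, ⟨0, 1⟩, ⟨3, -1⟩, ⟨1, 1⟩, ⟨0, 1⟩, ⟨3, -1⟩] i) ∧
      (∀ i, f.val i (i + 3) =
        ![⟨1, 1⟩, ⟨-3, 3⟩, ⟨0, 2⟩, ⟨1, 1⟩, ⟨-3, 3⟩, ⟨0, 2⟩] i) ∧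
      (⟨6, f⟩ : SqrtTwoFrieze) ∈ geOneFriezes ∧
      (⟨6, f⟩ : SqrtTwoFrieze) ∉ nonnegFriezes) ∧
    -- a unitary quadrilateral frieze in none of the other three classes
    (∃ f : Frieze 4 (ℤ√2),
      f.val 0 2 = ⟨-1, 1⟩ ∧ f.val 1 3 = ⟨2, 2⟩ ∧
      (⟨4, f⟩ : SqrtTwoFrieze) ∈ unitaryFriezes ∧
      (⟨4, f⟩ : SqrtTwoFrieze) ∉ geOneFriezes ∧
      (⟨4, f⟩ : SqrtTwoFrieze) ∉ nonnegFriezes ∧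
      (⟨4, f⟩ : SqrtTwoFrieze) ∉ dissectionFriezes) ∧
    -- the Euclidean frieze on the quadrilateral is from a dissection and not unitary
    (∃ f : Frieze 4 (ℤ√2),
      (∀ a b, sqrtTwoToReal (f.val a b) = euclideanFrieze 4 a b) ∧
      (⟨4, f⟩ : SqrtTwoFrieze) ∈ dissectionFriezes ∧
      (⟨4, f⟩ : SqrtTwoFrieze) ∉ unitaryFriezes) := by
  have hA := dissectionFriezes_subset_nonnegFriezes
  have hB := nonnegFriezes_subset_geOneFriezes
  have hL := euclideanQuadFrieze_mem_dissectionFriezes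
  have hL' := euclideanQuadFrieze_notMem_unitaryFriezes
  have hU := unitaryQuadFrieze_mem_unitaryFriezes
  have hU' := unitaryQuadFrieze_notMem_geOneFriezes
  refine ⟨Set.ssubset_iff_of_subset hA |>.2
      ⟨_, octagonFrieze_mem_nonnegFriezes, octagonFrieze_notMem_dissectionFriezes⟩,
    Set.ssubset_iff_of_subset hB |>.2
      ⟨_, hexagonFrieze_mem_geOneFriezes, hexagonFrieze_notMem_nonnegFriezes⟩,
    -- By the chain, a unitary frieze outside the largest class and a non-unitary one in the
    -- smallest settle all three incomparabilities.
    ⟨fun h => hU' (hB (hA (h hU))), fun h => hL' (h hL)⟩,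
    ⟨fun h => hU' (hB (h hU)), fun h => hL' (h (hA hL))⟩,
    ⟨fun h => hU' (h hU), fun h => hL' (h (hB (hA hL)))⟩,
    ⟨octagonFrieze, by decide +kernel, by decide +kernel, by decide +kernel,
      octagonFrieze_mem_nonnegFriezes, octagonFrieze_notMem_dissectionFriezes⟩,
    ⟨hexagonFrieze, by decide +kernel, by decide +kernel,
      hexagonFrieze_mem_geOneFriezes, hexagonFrieze_notMem_nonnegFriezes⟩,
    ⟨unitaryQuadFrieze, rfl, rfl, hU, hU', fun h => hU' (hB h), fun h => hU' (hB (hA h))⟩,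
    ⟨euclideanQuadFrieze, euclideanQuadFrieze_val, hL, hL'⟩⟩
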